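/- Let $2^{<\omega}$ be the set of finite $0$-$1$ sequences, and let $nwd$ be the ideal of all $A\subseteq 2^{<\omega}$ such that every $\sigma\in 2^{<\omega}$ has an extension $\tau\in 2^{<\omega}$ with $\rho\notin A$ for all $\rho\in 2^{<\omega}$ extending $\tau$. Fix any bijection between $2^{<\omega}$ and $\omega$, and regard $nwd$ as an ideal on $\omega$ through it. A tree is a set $T\subseteq\omega^{<\omega}$ closed under initial segments. Write $[T]=\{x\in\omega^\omega:\forall n\ x|_n\in T\}$ and $\mathrm{succ}_T(\sigma)=\{n:\sigma^\frown n\in T\}$; the stem of $T$ is its shortest node with more than one immediate successor. An $nwd$-Laver tree is a tree $T$ that has a stem and satisfies $\mathrm{succ}_T(\sigma)\notin nwd$ for every $\sigma\in T$ extending the stem. Let $\ell^0(nwd)$ be the collection of all $X\subseteq\omega^\omega$ such that every $nwd$-Laver tree $T$ contains an $nwd$-Laver tree $S\subseteq T$ with $[S]\cap X=\emptyset$, and let $\ell^0_{\mathcal B}(nwd)$ be the $\sigma$-ideal generated by the Borel sets in $\ell^0(nwd)$. Let $\mathrm{cov}(\ell^0_{\mathcal B}(nwd))$ be the least cardinality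 of a subfamily of $\ell^0_{\mathcal B}(nwd)$ whose union is $\omega^\omega$, and let $\mathrm{add}(\mathcal M)$ be the least cardinality of a family of meager subsets of $2^\omega$ whose union is not meager. Then $$\mathrm{cov}(\ell^0_{\mathcal B}(nwd))=\mathrm{add}(\mathcal M).$$ -/

import Mathlib

open Cardinal

namespace TreeIdeal

/-! ### Covering and additivity numbers of a family of small sets -/

section Invariants

variable {X : Type}

/-- `cov(J)`: the least size of a subfamily of `J` that covers the whole space. -/
noncomputable def cov (J : Set (Set X)) : Cardinal.{0} :=
  sInf {κ | ∃ F : Set (Set X), F ⊆ J ∧ ⋃₀ F = Set.univ ∧ #F = κ}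

/-- `add(J)`: the least size of a subfamily of `J` whose union is not in `J`. -/
noncomputable def add (J : Set (Set X)) : Cardinal.{0} :=
  sInf {κ | ∃ F : Set (Set X), F ⊆ J ∧ ⋃₀ F ∉ J ∧ #F = κ}

/-- The `σ`-ideal generated by a family `G` of sets. -/
def sigmaIdealGenerated (G : Set (Set X)) : Set (Set X) :=
  {A | ∃ F : Set (Set X), F ⊆ G ∧ F.Countable ∧ A ⊆ ⋃₀ F}

end Invariants

/-- The meager subsets of the Cantor space `2^ω`. -/
def meager : Set (Set (ℕ → Bool)) := {A | IsMeagre A}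

/-! ### Trees on `ω` -/

/-- The initial segment `x|ₙ` of `x ∈ ω^ω`. -/
def initSeg (x : ℕ → ℕ) (n : ℕ) : List ℕ := (List.range n).map x

/-- The body `[T]`: the set of branches of a tree `T ⊆ ω^{<ω}`. -/
def body (T : Descriptive.tree ℕ) : Set (ℕ → ℕ) := {x | ∀ n, initSeg x n ∈ T}

/-- The set of immediate successors of `σ` in `T`. -/
def succ (T : Descriptive.tree ℕ) (σ : List ℕ) : Set ℕ := {n | σ ++ [n] ∈ T}

/-- The set of splitting nodes of `T`. -/
def split (T : Descriptive.tree ℕ) : Set (List ℕ) := {σ | σ ∈ T ∧ (succ T σ).Nontrivial}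

/-- `s` is the stem of `T`, that is the shortest splitting node. -/
def IsStem (T : Descriptive.tree ℕ) (s : List ℕ) : Prop :=
  s ∈ split T ∧ ∀ t ∈ split T, s.length ≤ t.length

/-- The collection of `I`-Laver trees: trees that have a stem, and in which every node extending
the stem has an `I`-positive set of immediate successors. -/
def laverTrees (I : Order.Ideal (Set ℕ)) : Set (Descriptive.tree ℕ) :=
  {T | ∃ s, IsStem T s ∧ ∀ σ ∈ T, s <+: σ → succ T σ ∉ I}

/-- The tree ideal `t⁰` of a collection `𝕋` of trees. -/
def treeIdeal (𝕋 : Set (Descriptive.tree ℕ)) : Set (Set (ℕ → ℕ)) :=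
  {X | ∀ T ∈ 𝕋, ∃ S ∈ 𝕋, S ≤ T ∧ body S ∩ X = ∅}

/-- The Borel part of `t⁰`: the `σ`-ideal generated by the Borel sets in `t⁰`. -/
def borelPart (𝕋 : Set (Descriptive.tree ℕ)) : Set (Set (ℕ → ℕ)) :=
  sigmaIdealGenerated {X | X ∈ treeIdeal 𝕋 ∧ @MeasurableSet (ℕ → ℕ) (borel (ℕ → ℕ)) X}

/-! ### The ideal `nwd` -/

/-- The ideal `nwd` on `2^{<ω}`: the set `A` belongs to it if every `σ` has an extension `τ` such
that no extension of `τ` is in `A`. -/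
def nwd : Order.Ideal (Set (List Bool)) where
  carrier := {A | ∀ σ : List Bool, ∃ τ, σ <+: τ ∧ ∀ ρ, τ <+: ρ → ρ ∉ A}
  lower' := by
    intro A B hBA hA σ
    obtain ⟨τ, h1, h2⟩ := hA σ
    exact ⟨τ, h1, fun ρ hρ hB => h2 ρ hρ (hBA hB)⟩
  nonempty' := ⟨∅, fun σ => ⟨σ, List.prefix_rfl, fun _ _ h => h⟩⟩
  directed' := by
    intro A hA B hB
    refine ⟨A ∪ B, fun σ => ?_, Set.subset_union_left, Set.subset_union_right⟩
    obtain ⟨τ, h1, h2⟩ := hA σ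
    obtain ⟨υ, h3, h4⟩ := hB τ
    exact ⟨υ, h1.trans h3, fun ρ hρ h => h.elim (h2 ρ (h3.trans hρ)) (h4 ρ hρ)⟩

/-- The copy of `nwd` on `ω` under an enumeration `e` of `2^{<ω}`. -/
def nwdOn (e : List Bool ≃ ℕ) : Order.Ideal (Set ℕ) where
  carrier := {A | e ⁻¹' A ∈ nwd}
  lower' := fun _ _ hBA hA => nwd.lower (Set.preimage_mono hBA) hA
  nonempty' := ⟨∅, by
    obtain ⟨A, hA⟩ := nwd.nonempty
    exact nwd.lower (Set.empty_subset A) hA⟩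
  directed' := by
    intro A hA B hB
    refine ⟨A ∪ B, ?_, Set.subset_union_left, Set.subset_union_right⟩
    exact Order.Ideal.sup_mem (s := nwd) hA hB

end TreeIdeal

namespace TreeIdeal

open Filter Topology

/-! ### Initial segments -/

/-! The Borel part of the ideal has a combinatorial basis: the sets `hitSet φ`, where the predictor
`φ` takes values in $nwd$. Such a set lies in the ideal because the predicted successors can be
pruned from a Laver tree (`hitSet_mem_treeIdeal`). Conversely, an analytic set either is contained
in some `hitSet φ` or contains the body of a Laver tree (`range_subset_hitSet`,
`exists_laverTree_body_subset_range`), and the latter is impossible for members of the ideal. So the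
covering number is the least number of predictors that no single sequence evades.

`cov_le_add`: each meager set yields a predictor listing, at stage $k$, the strings seen at position
$k$ in its first few nowhere dense pieces. A sequence evading all these predictors gives strings
$s_k$ such that every point of the union passes through only finitely many $s_k$ at $k$, so the
union is meager.

`add_le_cov`: given fewer than $\mathrm{add}(\mathcal M)$ predictors, choose for each $\sigma$ a
real $c_\sigma$ whose long initial segments avoid all the sets predicted at $\sigma$. How long
depends on the predictor, but $\mathrm{add}(\mathcal M)\le\mathfrak b$ (`exists_bound_of_isMeagre`)
gives one length per $\sigma$ that suffices for all but finitely many $\sigma$; following these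
choices evades everything. -/

lemma initSeg_length (x : ℕ → ℕ) (n : ℕ) : (initSeg x n).length = n := by simp [initSeg]

lemma initSeg_zero (x : ℕ → ℕ) : initSeg x 0 = [] := rfl

lemma initSeg_succ (x : ℕ → ℕ) (n : ℕ) : initSeg x (n + 1) = initSeg x n ++ [x n] := by
  simp [initSeg, List.range_succ]

lemma take_initSeg (x : ℕ → ℕ) {m n : ℕ} (h : m ≤ n) : (initSeg x n).take m = initSeg x m := by
  simp [initSeg, ← List.map_take, List.take_range, min_eq_left h]

lemma initSeg_prefix (x : ℕ → ℕ) {m n : ℕ} (h : m ≤ n) : initSeg x m <+: initSeg x n := by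
  rw [← take_initSeg x h]; exact List.take_prefix _ _

lemma initSeg_injective (x : ℕ → ℕ) : Function.Injective (initSeg x) := fun m n h => by
  simpa [initSeg_length] using congrArg List.length h

lemma initSeg_add (x : ℕ → ℕ) (m n : ℕ) :
    initSeg x (m + n) = initSeg x m ++ initSeg (fun k => x (m + k)) n := by
  induction n with
  | zero => simp [initSeg_zero]
  | succ n ih => rw [← add_assoc, initSeg_succ, ih, initSeg_succ, List.append_assoc]

lemma initSeg_eq_iff {x y : ℕ → ℕ} {n : ℕ} : initSeg x n = initSeg y n ↔ ∀ i < n, x i = y i := by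
  simp [initSeg, List.map_inj_left]

/-- A rule prescribing each value in terms of the earlier ones is followed by some sequence. -/
lemma exists_forall_eq_initSeg (h : List ℕ → ℕ) : ∃ x : ℕ → ℕ, ∀ n, x n = h (initSeg x n) := by
  let L : ℕ → List ℕ := fun n => Nat.rec [] (fun _ l => l ++ [h l]) n
  have hL : ∀ n, initSeg (fun k => h (L k)) n = L n := by
    intro n
    induction n with
    | zero => rfl
    | succ n ih => rw [initSeg_succ, ih]
  exact ⟨fun k => h (L k), fun n => by rw [hL]⟩

/-! ### Sets of sequences caught infinitely often -/

/-- The sequences whose values are caught infinitely often by the predictor `φ`. -/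
def hitSet (φ : List ℕ → Set ℕ) : Set (ℕ → ℕ) := {x | ∃ᶠ n in atTop, x n ∈ φ (initSeg x n)}

lemma isOpen_setOf_mem_initSeg (φ : List ℕ → Set ℕ) (n : ℕ) :
    IsOpen {x : ℕ → ℕ | x n ∈ φ (initSeg x n)} := by
  have hc : Continuous fun x : ℕ → ℕ => fun i : Fin (n + 1) => x i := by fun_prop
  have : {x : ℕ → ℕ | x n ∈ φ (initSeg x n)} = (fun (x : ℕ → ℕ) (i : Fin (n + 1)) => x i) ⁻¹'
      ((fun (x : ℕ → ℕ) (i : Fin (n + 1)) => x i) '' {x : ℕ → ℕ | x n ∈ φ (initSeg x n)}) := by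
    refine (Set.subset_preimage_image _ _).antisymm ?_
    rintro x ⟨y, hy, hxy⟩
    have hxy' : ∀ i < n + 1, y i = x i := fun i hi => congrFun hxy ⟨i, hi⟩
    have hs : initSeg y n = initSeg x n :=
      initSeg_eq_iff.2 fun i hi => hxy' i (hi.trans n.lt_succ_self)
    simpa [hs, hxy' n n.lt_succ_self] using hy
  rw [this]
  exact (isOpen_discrete _).preimage hc

lemma measurableSet_hitSet (φ : List ℕ → Set ℕ) :
    @MeasurableSet (ℕ → ℕ) (borel (ℕ → ℕ)) (hitSet φ) := by
  let : MeasurableSpace (ℕ → ℕ) := borel _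
  have : BorelSpace (ℕ → ℕ) := ⟨rfl⟩
  have : hitSet φ = ⋂ N, ⋃ n, ⋃ (_ : N ≤ n), {x : ℕ → ℕ | x n ∈ φ (initSeg x n)} := by
    ext x
    simp [hitSet, frequently_atTop]
  rw [this]
  exact .iInter fun N => .iUnion fun n => .iUnion fun _ =>
    (isOpen_setOf_mem_initSeg φ n).measurableSet

/-- A branch passes through the stem. -/
lemma IsStem.initSeg_eq_take {T : Descriptive.tree ℕ} {s : List ℕ} (hs : IsStem T s)
    {x : ℕ → ℕ} (hx : x ∈ body T) {n : ℕ} (hn : n ≤ s.length) : initSeg x n = s.take n := by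
  induction n with
  | zero => simp [initSeg_zero]
  | succ n ih =>
    have ih := ih (by omega)
    rw [initSeg_succ, ih, ← List.take_append_getElem hn]
    congr 2
    by_contra hne
    have h1 : x n ∈ succ T (s.take n) := by
      have := hx (n + 1)
      rwa [initSeg_succ, ih] at this
    have h2 : s[n] ∈ succ T (s.take n) := by
      refine Descriptive.Tree.mem_of_prefix ?_ hs.1.1
      rw [List.take_append_getElem hn]
      exact List.take_prefix _ _
    have h3 := hs.2 (s.take n) ⟨ih ▸ hx n, x n, h1, s[n], h2, hne⟩
    rw [List.length_take] at h3
    omega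

section Ideal

variable {I : Order.Ideal (Set ℕ)}

lemma empty_mem_ideal : (∅ : Set ℕ) ∈ I := I.bot_mem

lemma union_mem_ideal {A B : Set ℕ} (hA : A ∈ I) (hB : B ∈ I) : A ∪ B ∈ I :=
  Order.Ideal.sup_mem hA hB

lemma biUnion_le_mem_ideal {A : ℕ → Set ℕ} (hA : ∀ k, A k ∈ I) (n : ℕ) :
    (⋃ k ≤ n, A k) ∈ I := by
  induction n with
  | zero => simpa using hA 0
  | succ n ih => rw [Set.biUnion_le_succ]; exact union_mem_ideal ih (hA _)

lemma nontrivial_of_notMem_ideal (hI : ∀ n, {n} ∈ I) {A : Set ℕ} (hA : A ∉ I) :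
    A.Nontrivial := by
  by_contra h
  rcases (Set.not_nontrivial_iff.1 h).eq_empty_or_singleton with h | ⟨n, h⟩
  · exact hA (h ▸ empty_mem_ideal)
  · exact hA (h ▸ hI n)

lemma diff_notMem_ideal {A B : Set ℕ} (hA : A ∉ I) (hB : B ∈ I) : A \ B ∉ I := fun h =>
  hA (I.lower (by simp : A ⊆ A \ B ∪ B) (union_mem_ideal h hB))

lemma nonempty_of_notMem_ideal {A : Set ℕ} (hA : A ∉ I) : A.Nonempty :=
  Set.nonempty_iff_ne_empty.2 fun h => hA (h ▸ empty_mem_ideal)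

lemma body_nonempty {T : Descriptive.tree ℕ} (hT : T ∈ laverTrees I) : (body T).Nonempty := by
  obtain ⟨s, hs, hT⟩ := hT
  have hex : ∀ σ, ∃ n, σ ∈ T → s <+: σ → σ ++ [n] ∈ T := fun σ => by
    by_cases h : σ ∈ T ∧ s <+: σ
    · obtain ⟨n, hn⟩ := nonempty_of_notMem_ideal (hT σ h.1 h.2)
      exact ⟨n, fun _ _ => hn⟩
    · exact ⟨0, fun h1 h2 => absurd ⟨h1, h2⟩ h⟩
  choose g hg using hex
  obtain ⟨x, hx⟩ := exists_forall_eq_initSeg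
    fun σ => if h : σ.length < s.length then s[σ.length] else g σ
  have h1 : ∀ n ≤ s.length, initSeg x n = s.take n := by
    intro n
    induction n with
    | zero => intro; simp [initSeg_zero]
    | succ n ih =>
      intro hn
      have hxn := hx n
      rw [initSeg_length, dif_pos (Nat.lt_of_succ_le hn)] at hxn
      rw [initSeg_succ, ih (by omega), hxn, List.take_append_getElem]
  have hs' : initSeg x s.length = s := by simpa using h1 _ le_rfl
  have h2 : ∀ n ≥ s.length, initSeg x n ∈ T := by
    intro n hn
    induction n, hn using Nat.le_induction with
    | base => rw [hs']; exact hs.1.1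
    | succ n hn ih =>
      have hxn := hx n
      rw [initSeg_length, dif_neg (not_lt.2 hn)] at hxn
      rw [initSeg_succ, hxn]
      exact hg _ ih (hs' ▸ initSeg_prefix x hn)
  exact ⟨x, fun n => Descriptive.Tree.mem_of_prefix (initSeg_prefix x (le_max_left n s.length))
    (h2 _ (le_max_right _ _))⟩

/-- Removing a set in `I` from a positive set of successors leaves it positive, so above the stem
every predicted value can be pruned; a branch of the pruned tree can be caught only below the stem.
-/
lemma hitSet_mem_treeIdeal (hI : ∀ n, {n} ∈ I) {φ : List ℕ → Set ℕ} (hφ : ∀ σ, φ σ ∈ I) :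
    hitSet φ ∈ treeIdeal (laverTrees I) := by
  rintro T ⟨s, hs, hT⟩
  let S : Descriptive.tree ℕ := ⟨{ρ | ρ ∈ T ∧ ∀ σ n, s <+: σ → σ ++ [n] <+: ρ → n ∉ φ σ},
    fun ρ a hρ => ⟨T.2 hρ.1, fun σ n h1 h2 => hρ.2 σ n h1 (h2.trans (List.prefix_append _ _))⟩⟩
  have hS : ∀ ρ, ρ ∈ S ↔ ρ ∈ T ∧ ∀ σ n, s <+: σ → σ ++ [n] <+: ρ → n ∉ φ σ := fun _ => Iff.rfl
  have hST : S ≤ T := fun ρ hρ => hρ.1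
  have hsucc : ∀ ρ ∈ S, s <+: ρ → succ S ρ ∉ I := by
    intro ρ hρ hsρ
    refine fun hmem => diff_notMem_ideal (hT ρ hρ.1 hsρ) (hφ ρ) (I.lower ?_ hmem)
    rintro n ⟨hn, hnφ⟩
    refine (hS _).2 ⟨hn, fun σ m h1 h2 => ?_⟩
    rcases List.prefix_concat_iff.1 h2 with h | h
    · obtain ⟨rfl, rfl⟩ : σ = ρ ∧ m = n := by simpa using h
      exact hnφ
    · exact hρ.2 σ m h1 h
  have hsS : s ∈ S := by
    refine (hS _).2 ⟨hs.1.1, fun σ n h1 h2 => ?_⟩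
    have := h1.length_le
    have := h2.length_le
    simp at this
    omega
  refine ⟨S, ⟨s, ⟨⟨hsS, nontrivial_of_notMem_ideal hI (hsucc s hsS List.prefix_rfl)⟩,
    fun t ht => hs.2 t ⟨hST ht.1, ht.2.mono fun n hn => hST hn⟩⟩, hsucc⟩, hST, ?_⟩
  refine Set.eq_empty_iff_forall_notMem.2 fun x hx => ?_
  obtain ⟨n, hn, hxn⟩ := frequently_atTop.1 hx.2 s.length
  have hsx : s <+: initSeg x n := by
    have h1 : initSeg x s.length = s := by
      simpa using hs.initSeg_eq_take (fun n => hST (hx.1 n)) le_rfl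
    exact h1 ▸ initSeg_prefix x hn
  exact (hx.1 (n + 1)).2 _ _ hsx (by rw [initSeg_succ]) hxn

end Ideal

/-! ### Laver trees from strategies -/

section Strategy

variable {S : Type} (M : S → Set ℕ) (step : S → ℕ → S)

/-- `l` is a sequence of moves allowed by `M`, starting in the state `s`. -/
def Legal : S → List ℕ → Prop
  | _, [] => True
  | s, n :: l => n ∈ M s ∧ Legal (step s n) l

lemma legal_append_singleton (s : S) (l : List ℕ) (n : ℕ) :
    Legal M step s (l ++ [n]) ↔ Legal M step s l ∧ n ∈ M (l.foldl step s) := by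
  induction l generalizing s with
  | nil => simp [Legal]
  | cons a l ih => simp [Legal, ih, and_assoc]

/-- The tree of the nodes `σ ++ l` with `l` legal from `s`, and of the initial segments of `σ`. -/
def strategyTree (σ : List ℕ) (s : S) : Descriptive.tree ℕ :=
  ⟨{ρ | ρ <+: σ ∨ ∃ l, ρ = σ ++ l ∧ Legal M step s l}, by
    rintro ρ a (h | ⟨l, hl, hleg⟩)
    · exact .inl ((List.prefix_append _ _).trans h)
    · rcases List.eq_nil_or_concat' l with rfl | ⟨l, b, rfl⟩
      · left
        rw [List.append_nil] at hl
        exact hl ▸ List.prefix_append _ _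
      · rw [← List.append_assoc] at hl
        exact .inr ⟨l, (List.append_inj' hl rfl).1, ((legal_append_singleton M step _ _ _).1 hleg).1⟩⟩

variable {M step}

lemma mem_strategyTree {σ : List ℕ} {s : S} {ρ : List ℕ} :
    ρ ∈ strategyTree M step σ s ↔ ρ <+: σ ∨ ∃ l, ρ = σ ++ l ∧ Legal M step s l := Iff.rfl

lemma append_mem_strategyTree {σ : List ℕ} {s : S} {l : List ℕ} :
    σ ++ l ∈ strategyTree M step σ s ↔ Legal M step s l := by
  rw [mem_strategyTree]
  constructor
  · rintro (h | ⟨l', hl', h⟩)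
    · have := h.length_le
      obtain rfl : l = [] := by simpa using this
      trivial
    · rwa [List.append_cancel_left hl']
  · exact fun h => .inr ⟨l, rfl, h⟩

lemma strategyTree_mem_laverTrees {I : Order.Ideal (Set ℕ)} (hI : ∀ n, {n} ∈ I)
    (hM : ∀ s, M s ∉ I) (σ : List ℕ) (s : S) : strategyTree M step σ s ∈ laverTrees I := by
  have key : ∀ ρ ∈ strategyTree M step σ s, σ <+: ρ → succ (strategyTree M step σ s) ρ ∉ I := by
    rintro ρ hρ ⟨l, rfl⟩
    rw [append_mem_strategyTree] at hρ
    have : succ (strategyTree M step σ s) (σ ++ l) = M (l.foldl step s) := by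
      ext n
      change σ ++ l ++ [n] ∈ strategyTree M step σ s ↔ _
      rw [List.append_assoc, append_mem_strategyTree, legal_append_singleton]
      exact and_iff_right hρ
    rw [this]
    exact hM _
  have hσ : σ ∈ strategyTree M step σ s := .inl List.prefix_rfl
  refine ⟨σ, ⟨⟨hσ, nontrivial_of_notMem_ideal hI (key σ hσ List.prefix_rfl)⟩, ?_⟩, key⟩
  rintro t ⟨-, a, ha, b, hb, hab⟩
  by_contra! hlt
  have aux : ∀ c : ℕ, t ++ [c] ∈ strategyTree M step σ s → t ++ [c] <+: σ := by
    rintro c (h | ⟨l, hl, -⟩)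
    · exact h
    · have hp : σ <+: t ++ [c] := hl ▸ List.prefix_append σ l
      exact hp.eq_of_length_le (by simpa using hlt) ▸ List.prefix_rfl
  have h1 := List.prefix_iff_eq_take.1 (aux a ha)
  have h2 := List.prefix_iff_eq_take.1 (aux b hb)
  rw [List.length_append, List.length_singleton] at h1 h2
  exact hab (by simpa using h1.trans h2.symm)

lemma mem_body_strategyTree {σ : List ℕ} {s : S} {x : ℕ → ℕ}
    (hx : x ∈ body (strategyTree M step σ s)) : initSeg x σ.length = σ ∧
      ∀ n, Legal M step s (initSeg (fun k => x (σ.length + k)) n) := by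
  have h1 : initSeg x σ.length = σ := by
    rcases hx σ.length with h | ⟨l, hl, -⟩
    · exact h.eq_of_length (initSeg_length _ _)
    · have := congrArg List.length hl
      rw [initSeg_length, List.length_append] at this
      obtain rfl : l = [] := List.length_eq_zero_iff.1 (by omega)
      simpa using hl
  refine ⟨h1, fun n => ?_⟩
  have := hx (σ.length + n)
  rwa [initSeg_add, h1, append_mem_strategyTree] at this

lemma legal_run {s : S} {z : ℕ → ℕ} (hz : ∀ n, Legal M step s (initSeg z n)) :
    ∃ P : ℕ → S, P 0 = s ∧ (∀ n, z n ∈ M (P n)) ∧ ∀ n, P (n + 1) = step (P n) (z n) := by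
  refine ⟨fun n => (initSeg z n).foldl step s, rfl, fun n => ?_, fun n => ?_⟩
  · have := hz (n + 1)
    rw [initSeg_succ, legal_append_singleton] at this
    exact this.2
  · simp [initSeg_succ]

lemma exists_run_of_mem_body {σ : List ℕ} {s : S} {x : ℕ → ℕ}
    (hx : x ∈ body (strategyTree M step σ s)) : ∃ P : ℕ → S, P 0 = s ∧
      (∀ n, x (σ.length + n) ∈ M (P n)) ∧ ∀ n, P (n + 1) = step (P n) (x (σ.length + n)) :=
  legal_run (mem_body_strategyTree hx).2

end Strategy

/-! ### The dichotomy for analytic sets -/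

section Dichotomy

variable (I : Order.Ideal (Set ℕ)) (f : (ℕ → ℕ) → ℕ → ℕ)

/-- Some predictor catches, above `σ`, all values of `f` extending `σ` at arguments extending
`t`. -/
def SmallAt (σ t : List ℕ) : Prop :=
  ∃ ψ : List ℕ → Set ℕ, (∀ τ, ψ τ ∈ I) ∧ ∀ y, initSeg y t.length = t →
    initSeg (f y) σ.length = σ → ∃ n ≥ σ.length, f y n ∈ ψ (initSeg (f y) n)

/-- Witnesses that from `τ` one can pass through positive sets of successors, until reaching nodes
that are not small for some immediate extension of `t`. -/
inductive Wit (t : List ℕ) : List ℕ → Type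
  | mk (τ : List ℕ) (B C : Set ℕ) (hpos : B ∪ C ∉ I)
      (hB : ∀ n ∈ B, ∃ m, ¬ SmallAt I f (τ ++ [n]) (t ++ [m]))
      (hC : ∀ n ∈ C, Wit t (τ ++ [n])) : Wit t τ

variable {I f}

/-- Diagonal merging: at `ρ` only the predictors indexed by initial segments of `ρ` and by `m ≤
ρ.length` are united, a finite union. The condition `m ≤ k` ensures that a hit at or after `k` is
counted. -/
lemma exists_predictor_of_smallAt (A : List ℕ → Set ℕ) (hA : ∀ τ, A τ ∈ I)
    (w : ℕ → List ℕ) : ∃ ψ : List ℕ → Set ℕ, (∀ τ, ψ τ ∈ I) ∧ (∀ τ, A τ ⊆ ψ τ) ∧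
      ∀ k m y, SmallAt I f (initSeg (f y) k) (w m) → initSeg y (w m).length = w m →
        m ≤ k → ∃ n ≥ k, f y n ∈ ψ (initSeg (f y) n) := by
  have hex : ∀ τ m, ∃ ψ : List ℕ → Set ℕ, (∀ ρ, ψ ρ ∈ I) ∧ (SmallAt I f τ (w m) →
      ∀ y, initSeg y (w m).length = w m →
        initSeg (f y) τ.length = τ → ∃ n ≥ τ.length, f y n ∈ ψ (initSeg (f y) n)) := by
    intro τ m
    by_cases h : SmallAt I f τ (w m)
    · obtain ⟨ψ, h1, h2⟩ := h
      exact ⟨ψ, h1, fun _ => h2⟩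
    · exact ⟨fun _ => ∅, fun _ => empty_mem_ideal, fun h' => absurd h' h⟩
  choose Ψ hΨ hΨ' using hex
  refine ⟨fun ρ => A ρ ∪ ⋃ k ≤ ρ.length, ⋃ m ≤ ρ.length, Ψ (ρ.take k) m ρ, fun ρ =>
    union_mem_ideal (hA ρ) (biUnion_le_mem_ideal (fun k => biUnion_le_mem_ideal
      (fun m => hΨ _ _ _) _) _), fun ρ => Set.subset_union_left, fun k m y hs hy hmk => ?_⟩
  obtain ⟨n, hn, hmem⟩ := hΨ' _ m hs y hy (by rw [initSeg_length])
  rw [initSeg_length] at hn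
  refine ⟨n, hn, .inr ?_⟩
  simp only [Set.mem_iUnion, initSeg_length]
  exact ⟨k, hn, m, hmk.trans hn, by rwa [take_initSeg _ hn]⟩

/-- If the merged predictor never caught `f y`, then `f y` would stay in `Q` forever, where
smallness for the next value of `y` forces a hit. -/
lemma smallAt_of_closed (Q : Set (List ℕ)) (A : List ℕ → Set ℕ) (hA : ∀ τ, A τ ∈ I) {σ t : List ℕ}
    (hσ : σ ∈ Q) (hQ : ∀ τ ∈ Q, ∀ n ∉ A τ, τ ++ [n] ∈ Q ∧ ∀ m, SmallAt I f (τ ++ [n]) (t ++ [m])) :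
    SmallAt I f σ t := by
  obtain ⟨ψ, hψ, hAψ, hw⟩ := exists_predictor_of_smallAt (f := f) A hA fun m => t ++ [m]
  refine ⟨ψ, hψ, fun y hy hfy => ?_⟩
  by_contra! hcon
  have hmem : ∀ n ≥ σ.length, initSeg (f y) n ∈ Q := by
    intro n hn
    induction n, hn using Nat.le_induction with
    | base => rwa [hfy]
    | succ n hn ih =>
      rw [initSeg_succ]
      exact (hQ _ ih _ fun h => hcon n hn (hAψ _ h)).1
  obtain ⟨N, hN⟩ : ∃ N, N = max σ.length (y t.length) := ⟨_, rfl⟩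
  have hN1 : σ.length ≤ N := hN ▸ le_max_left _ _
  have hN2 : y t.length ≤ N := hN ▸ le_max_right _ _
  have hs := (hQ _ (hmem N hN1) _ fun h => hcon N hN1 (hAψ _ h)).2 (y t.length)
  rw [← initSeg_succ] at hs
  obtain ⟨n, hn, hn'⟩ := hw (N + 1) (y t.length) y hs
    (by rw [List.length_append, List.length_singleton, initSeg_succ, hy]) (by omega)
  exact hcon n (by omega) hn'

/-- The nodes without a witness form a closed set in the sense of `smallAt_of_closed`: the
successors that leave it, or that fail to be small for some extension of `t`, form a set in `I`,
since otherwise they would make up a witness. -/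
lemma exists_wit {σ t : List ℕ} (h : ¬ SmallAt I f σ t) : Nonempty (Wit I f t σ) := by
  by_contra hσ
  let B : List ℕ → Set ℕ := fun τ => {n | ∃ m, ¬ SmallAt I f (τ ++ [n]) (t ++ [m])}
  let C : List ℕ → Set ℕ := fun τ => {n | Nonempty (Wit I f t (τ ++ [n]))}
  have hpos : ∀ τ, ¬ Nonempty (Wit I f t τ) → B τ ∪ C τ ∈ I := fun τ hτ => by
    by_contra hp
    exact hτ ⟨.mk τ (B τ) (C τ) hp (fun _ h => h) fun _ h => h.some⟩
  classical
  refine h (smallAt_of_closed {τ | ¬ Nonempty (Wit I f t τ)}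
    (fun τ => if Nonempty (Wit I f t τ) then ∅ else B τ ∪ C τ) (fun τ => ?_) hσ ?_)
  · split_ifs with hτ
    exacts [empty_mem_ideal, hpos τ hτ]
  · intro τ hτ n hn
    rw [if_neg hτ] at hn
    refine ⟨fun hw => hn (.inr hw), fun m => ?_⟩
    by_contra hm
    exact hn (.inl ⟨m, hm⟩)

lemma range_subset_hitSet (h : ∀ σ, SmallAt I f σ []) :
    ∃ φ : List ℕ → Set ℕ, (∀ σ, φ σ ∈ I) ∧ Set.range f ⊆ hitSet φ := by
  obtain ⟨ψ, hψ, -, hw⟩ := exists_predictor_of_smallAt (f := f) (fun _ => ∅)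
    (fun _ => empty_mem_ideal) fun _ => []
  refine ⟨ψ, hψ, ?_⟩
  rintro _ ⟨y, rfl⟩
  exact frequently_atTop.2 fun k => hw k 0 y (h _) rfl k.zero_le

variable (I f)

/-- The positions in the construction of a Laver tree of values of `f`. -/
structure Pos where
  node : List ℕ
  arg : List ℕ
  wit : Wit I f arg node

variable {I f}

/-- The moves offered by a witness. -/
def Wit.moves {t τ : List ℕ} : Wit I f t τ → Set ℕ
  | .mk _ B C _ _ _ => B ∪ C

lemma Wit.moves_notMem {t τ : List ℕ} (w : Wit I f t τ) : w.moves ∉ I := by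
  cases w; assumption

open Classical in
/-- The position after a move; the argument grows as soon as the witness allows it. -/
noncomputable def Wit.next {t τ : List ℕ} : Wit I f t τ → ℕ → Pos I f
  | .mk τ B C hp hB hC, n =>
    if h : n ∈ B then ⟨τ ++ [n], t ++ [(hB n h).choose], (exists_wit (hB n h).choose_spec).some⟩
    else if h' : n ∈ C then ⟨τ ++ [n], t, hC n h'⟩
    -- Reached only by illegal moves; the value is immaterial.
    else ⟨τ, t, .mk τ B C hp hB hC⟩

lemma Wit.next_node {t τ : List ℕ} (w : Wit I f t τ) {n : ℕ} (hn : n ∈ w.moves) :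
    (w.next n).node = τ ++ [n] := by
  cases w with
  | mk τ B C hp hB hC =>
    simp only [Wit.next]
    split_ifs with h h'
    · rfl
    · rfl
    · exact absurd hn (not_or.2 ⟨h, h'⟩)

/-- Witnesses are well-founded: each legal move either lengthens the argument or passes to a
subwitness, so the argument grows after finitely many moves. -/
lemma Wit.exists_progress {z : ℕ → ℕ} {P : ℕ → Pos I f}
    (hz : ∀ n, z n ∈ (P n).wit.moves) (hP : ∀ n, P (n + 1) = (P n).wit.next (z n))
    {t τ : List ℕ} (w : Wit I f t τ) (N : ℕ) (hN : P N = ⟨τ, t, w⟩) :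
    ∃ n > N, ∃ m, (P n).arg = t ++ [m] ∧ ¬ SmallAt I f (P n).node (P n).arg := by
  induction w generalizing N with
  | mk τ B C hp hB hC ih =>
    have hz' := hz N
    have hP' := hP N
    rw [hN] at hz' hP'
    simp only [Wit.next] at hP'
    by_cases h : z N ∈ B
    · rw [dif_pos h] at hP'
      refine ⟨N + 1, by omega, (hB _ h).choose, ?_⟩
      rw [hP']
      exact ⟨rfl, (hB _ h).choose_spec⟩
    · have h' : z N ∈ C := hz'.resolve_left h
      rw [dif_neg h, dif_pos h'] at hP'
      obtain ⟨n, hn, hn'⟩ := ih _ h' _ hP'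
      exact ⟨n, by omega, hn'⟩

lemma exists_of_not_smallAt {σ t : List ℕ} (h : ¬ SmallAt I f σ t) :
    ∃ y, initSeg y t.length = t ∧ initSeg (f y) σ.length = σ := by
  by_contra! hcon
  exact h ⟨fun _ => ∅, fun _ => empty_mem_ideal, fun y h1 h2 => absurd h2 (hcon y h1)⟩

lemma exists_forall_initSeg_eq_apply (hf : Continuous f) (y : ℕ → ℕ) (i : ℕ) :
    ∃ k, ∀ y', initSeg y' k = initSeg y k → f y' i = f y i := by
  have ho : IsOpen {y' | f y' i = f y i} :=
    (isOpen_discrete {f y i}).preimage ((continuous_apply i).comp hf)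
  obtain ⟨U, ⟨x, k, rfl⟩, hyU, hU⟩ :=
    (PiNat.isTopologicalBasis_cylinders fun _ : ℕ => ℕ).exists_subset_of_mem_open
      (show y ∈ {y' | f y' i = f y i} from rfl) ho
  refine ⟨k, fun y' hy' => hU ?_⟩
  rw [← PiNat.mem_cylinder_iff_eq.1 hyU]
  exact fun j hj => initSeg_eq_iff.1 hy' j hj

/-- Along a branch `x` of the strategy the arguments grow to some `y`. Non-smallness supplies points
near `y` whose images agree with long initial segments of `x`, so `f y = x` by continuity. -/
lemma exists_laverTree_body_subset_range (hI : ∀ n, {n} ∈ I) (hf : Continuous f) {σ : List ℕ}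
    (h : ¬ SmallAt I f σ []) : ∃ T ∈ laverTrees I, body T ⊆ Set.range f := by
  let p : Pos I f := ⟨σ, [], (exists_wit h).some⟩
  refine ⟨_, strategyTree_mem_laverTrees (M := fun p : Pos I f => p.wit.moves)
    (step := fun p => p.wit.next) hI (fun p => p.wit.moves_notMem) σ p, fun x hx => ?_⟩
  obtain ⟨P, hP0, hz, hP⟩ := exists_run_of_mem_body hx
  have hσx := (mem_body_strategyTree hx).1
  have hnode : ∀ n, (P n).node = initSeg x (σ.length + n) := by
    intro n
    induction n with
    | zero => rw [hP0, add_zero, hσx]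
    | succ n ih => rw [hP, Wit.next_node _ (hz n), ih, ← add_assoc, initSeg_succ]
  choose next hlt m harg hns using fun n => Wit.exists_progress hz hP (P n).wit n rfl
  let ν : ℕ → ℕ := fun j => next^[j] 0
  have hν : ∀ j, ν (j + 1) = next (ν j) := fun j => Function.iterate_succ_apply' _ _ _
  have hνj : ∀ j, j ≤ ν j := fun j => by
    induction j with
    | zero => exact Nat.zero_le _
    | succ j ih => rw [hν]; exact Nat.succ_le_of_lt (ih.trans_lt (hlt _))
  have hy : ∀ j, (P (ν j)).arg = initSeg (fun j => m (ν j)) j := fun j => by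
    induction j with
    | zero => change (P 0).arg = _; rw [hP0]; rfl
    | succ j ih => rw [hν, harg, ih, initSeg_succ]
  refine ⟨fun j => m (ν j), funext fun i => ?_⟩
  obtain ⟨k, hk⟩ := exists_forall_initSeg_eq_apply hf (fun j => m (ν j)) i
  -- Late enough that the argument determines `f` at `i` and the node already contains `x i`.
  have hsmall := hns (ν (max k i))
  rw [← hν, hy, hnode] at hsmall
  obtain ⟨y', h1, h2⟩ := exists_of_not_smallAt hsmall
  rw [initSeg_length, initSeg_eq_iff] at h1 h2
  have hle := hνj (max k i + 1)
  have hk' := le_max_left k i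
  have hi' := le_max_right k i
  rw [← hk y' (initSeg_eq_iff.2 fun j hj => h1 j (by omega)), h2 i (by omega)]

/-- The elements of a Borel set in the tree ideal are caught infinitely often by one predictor. -/
lemma exists_subset_hitSet (hI : ∀ n, {n} ∈ I) {X : Set (ℕ → ℕ)}
    (hX : X ∈ treeIdeal (laverTrees I)) (hB : @MeasurableSet (ℕ → ℕ) (borel (ℕ → ℕ)) X) :
    ∃ φ : List ℕ → Set ℕ, (∀ σ, φ σ ∈ I) ∧ X ⊆ hitSet φ := by
  let : MeasurableSpace (ℕ → ℕ) := borel _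
  have : BorelSpace (ℕ → ℕ) := ⟨rfl⟩
  have hA : MeasureTheory.AnalyticSet X := hB.analyticSet
  rw [MeasureTheory.AnalyticSet] at hA
  rcases hA with rfl | ⟨f, hf, rfl⟩
  · exact ⟨fun _ => ∅, fun _ => empty_mem_ideal, Set.empty_subset _⟩
  · by_cases h : ∀ σ, SmallAt I f σ []
    · exact range_subset_hitSet h
    · push Not at h
      obtain ⟨σ, hσ⟩ := h
      obtain ⟨T, hT, hTf⟩ := exists_laverTree_body_subset_range hI hf hσ
      obtain ⟨S, hS, hST, hSX⟩ := hX T hT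
      obtain ⟨x, hx⟩ := body_nonempty hS
      exact absurd (show x ∈ body S ∩ Set.range f from ⟨hx, hTf fun n => hST (hx n)⟩)
        (hSX ▸ Set.notMem_empty x)

lemma hitSet_mem_borelPart (hI : ∀ n, {n} ∈ I) {φ : List ℕ → Set ℕ} (hφ : ∀ σ, φ σ ∈ I) :
    hitSet φ ∈ borelPart (laverTrees I) :=
  ⟨{hitSet φ}, Set.singleton_subset_iff.2 ⟨hitSet_mem_treeIdeal hI hφ, measurableSet_hitSet φ⟩,
    Set.countable_singleton _, by simp⟩

lemma exists_subset_hitSet_of_mem_borelPart (hI : ∀ n, {n} ∈ I) {X : Set (ℕ → ℕ)}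
    (hX : X ∈ borelPart (laverTrees I)) :
    ∃ φ : List ℕ → Set ℕ, (∀ σ, φ σ ∈ I) ∧ X ⊆ hitSet φ := by
  obtain ⟨F, hF, hFc, hXF⟩ := hX
  rcases F.eq_empty_or_nonempty with rfl | hne
  · exact ⟨fun _ => ∅, fun _ => empty_mem_ideal, hXF.trans (by simp)⟩
  obtain ⟨A, rfl⟩ := hFc.exists_eq_range hne
  choose φ hφ hA using fun n => exists_subset_hitSet hI (hF ⟨n, rfl⟩).1 (hF ⟨n, rfl⟩).2
  -- `I` need not be a σ-ideal, so the `k`-th predictor joins only from length `k` on; infinitely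
  -- many hits survive this.
  refine ⟨fun σ => ⋃ k ≤ σ.length, φ k σ, fun σ => biUnion_le_mem_ideal (fun k => hφ k σ) _, ?_⟩
  intro x hx
  obtain ⟨_, ⟨k, rfl⟩, hk⟩ := hXF hx
  refine ((hA k hk).and_eventually (eventually_ge_atTop k)).mono ?_
  rintro n ⟨hn, hkn⟩
  simp only [Set.mem_iUnion, initSeg_length]
  exact ⟨k, hkn, hn⟩

end Dichotomy

/-! ### Category in the Cantor space -/

/-- `y` takes the values listed in `s` from the position `N` on. -/
def Passes (y : ℕ → Bool) (N : ℕ) (s : List Bool) : Prop :=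
  ∀ i < s.length, s[i]? = some (y (N + i))

lemma passes_append {y : ℕ → Bool} {N : ℕ} {s t : List Bool} :
    Passes y N (s ++ t) ↔ Passes y N s ∧ Passes y (N + s.length) t := by
  constructor
  · refine fun h => ⟨fun i hi => ?_, fun i hi => ?_⟩
    · rw [← h i (by rw [List.length_append]; omega), List.getElem?_append_left hi]
    · have := h (s.length + i) (by rw [List.length_append]; omega)
      rwa [List.getElem?_append_right (by omega), Nat.add_sub_cancel_left, ← add_assoc] at this
  · rintro ⟨h1, h2⟩ i hi
    rcases lt_or_ge i s.length with h | h
    · rw [List.getElem?_append_left h, h1 i h]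
    · rw [List.getElem?_append_right h, h2 (i - s.length) (by rw [List.length_append] at hi; omega)]
      congr 2
      omega

lemma Passes.of_prefix {y : ℕ → Bool} {N : ℕ} {s t : List Bool} (h : Passes y N t)
    (hst : s <+: t) : Passes y N s := by
  obtain ⟨r, rfl⟩ := hst
  exact (passes_append.1 h).1

lemma passes_map_range (y : ℕ → Bool) (n : ℕ) : Passes y 0 ((List.range n).map y) := by
  intro i hi
  simp at hi
  simp [hi]

lemma exists_passes (s : List Bool) : ∃ y, Passes y 0 s :=
  ⟨fun i => s.getD i false, fun i hi => by simp [hi]⟩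

lemma passes_of_passes_of_length_eq {y z : ℕ → Bool} {n : ℕ}
    (h : Passes y 0 ((List.range n).map z)) {i : ℕ} (hi : i < n) : y i = z i := by
  have := h i (by simpa using hi)
  simp [hi] at this
  exact this.symm

lemma isOpen_setOf_passes (s : List Bool) : IsOpen {y | Passes y 0 s} := by
  have : {y | Passes y 0 s} = ⋂ i ∈ Set.Iio s.length, {y : ℕ → Bool | s[i]? = some (y (0 + i))} := by
    ext y; simp [Passes]
  rw [this]
  refine (Set.finite_Iio _).isOpen_biInter fun i _ => ?_
  have hc : Continuous fun y : ℕ → Bool => y (0 + i) := continuous_apply _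
  exact (isOpen_discrete {b : Bool | s[i]? = some b}).preimage hc

lemma exists_passes_subset {O : Set (ℕ → Bool)} (hO : IsOpen O) {z : ℕ → Bool} (hz : z ∈ O) :
    ∃ k, ∀ n ≥ k, ∀ y, Passes y 0 ((List.range n).map z) → y ∈ O := by
  obtain ⟨U, ⟨x, k, rfl⟩, hyU, hU⟩ :=
    (PiNat.isTopologicalBasis_cylinders fun _ : ℕ => Bool).exists_subset_of_mem_open hz hO
  refine ⟨k, fun n hn y hy => hU ?_⟩
  rw [← PiNat.mem_cylinder_iff_eq.1 hyU]
  exact fun j hj => passes_of_passes_of_length_eq hy (lt_of_lt_of_le hj hn)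

lemma isNowhereDense_iff_forall_exists_prefix {C : Set (ℕ → Bool)} :
    IsNowhereDense C ↔ ∀ σ : List Bool, ∃ τ, σ <+: τ ∧ ∀ y ∈ C, ¬ Passes y 0 τ := by
  constructor
  · intro hC σ
    have h1 : ¬ {y | Passes y 0 σ} ⊆ closure C := fun h => by
      obtain ⟨y, hy⟩ := exists_passes σ
      have : y ∈ interior (closure C) := interior_maximal h (isOpen_setOf_passes σ) hy
      rw [hC] at this
      exact this
    obtain ⟨z, hzσ, hzC⟩ := Set.not_subset.1 h1
    obtain ⟨k, hk⟩ := exists_passes_subset isClosed_closure.isOpen_compl hzC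
    refine ⟨(List.range (max k σ.length)).map z, ?_, fun y hy hp =>
      hk _ (le_max_left _ _) y hp (subset_closure hy)⟩
    rw [List.prefix_iff_getElem?]
    intro i hi
    have := hzσ i hi
    rw [List.getElem?_eq_getElem hi, zero_add] at this
    rw [List.getElem?_map, List.getElem?_range (lt_max_of_lt_right hi), this]
    rfl
  · intro h
    refine Set.eq_empty_iff_forall_notMem.2 fun z hz => ?_
    obtain ⟨k, hk⟩ := exists_passes_subset isOpen_interior hz
    obtain ⟨τ, ⟨r, rfl⟩, hτ⟩ := h ((List.range k).map z)
    obtain ⟨y, hy⟩ := exists_passes ((List.range k).map z ++ r)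
    obtain ⟨c, hc1, hc2⟩ := mem_closure_iff.1
      (interior_subset (hk k le_rfl y (passes_append.1 hy).1)) _ (isOpen_setOf_passes _) hy
    exact hτ c hc2 hc1

lemma mem_nwd {A : Set (List Bool)} :
    A ∈ nwd ↔ ∀ σ : List Bool, ∃ τ, σ <+: τ ∧ ∀ ρ, τ <+: ρ → ρ ∉ A := Iff.rfl

/-- The strings found at the position `N` in elements of a nowhere dense set. -/
lemma setOf_exists_passes_mem_nwd {C : Set (ℕ → Bool)} (hC : IsNowhereDense C) (N : ℕ) :
    {s | ∃ y ∈ C, Passes y N s} ∈ nwd := by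
  rw [isNowhereDense_iff_forall_exists_prefix] at hC
  -- The `N` bits before the string are unknown, but there are finitely many possibilities `u`; they
  -- are treated one after another by extending `τ`.
  have key : ∀ U : Set (List Bool), U.Finite → ∀ σ : List Bool, ∃ τ, σ <+: τ ∧
      ∀ u ∈ U, ∀ y ∈ C, ¬ Passes y 0 (u ++ τ) := by
    intro U hU
    induction U, hU using Set.Finite.induction_on with
    | empty => exact fun σ => ⟨σ, List.prefix_rfl, by simp⟩
    | @insert u U _ _ ih =>
      intro σ
      obtain ⟨τ, h1, h2⟩ := ih σ
      obtain ⟨_, ⟨r, rfl⟩, h3⟩ := hC (u ++ τ)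
      refine ⟨τ ++ r, h1.trans (List.prefix_append _ _), ?_⟩
      rintro v (rfl | hv) y hy
      · rw [← List.append_assoc]; exact h3 y hy
      · refine fun h => h2 v hv y hy (h.of_prefix ?_)
        rw [← List.append_assoc]; exact List.prefix_append _ _
  refine mem_nwd.2 fun σ => ?_
  obtain ⟨τ, h1, h2⟩ := key {l | l.length = N} (List.finite_length_eq _ _) σ
  refine ⟨τ, h1, ?_⟩
  rintro ρ hρ ⟨y, hy, hp⟩
  refine h2 ((List.range N).map y) (by simp) y hy
    (passes_append.2 ⟨passes_map_range y N, ?_⟩)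
  simpa using hp.of_prefix hρ

lemma biUnion_le_mem_nwd {A : ℕ → Set (List Bool)} (hA : ∀ k, A k ∈ nwd) (n : ℕ) :
    (⋃ k ≤ n, A k) ∈ nwd := by
  induction n with
  | zero => simpa using hA 0
  | succ n ih => rw [Set.biUnion_le_succ]; exact Order.Ideal.sup_mem ih (hA _)

/-- The traces of a meager set belong to `nwd`. -/
lemma IsMeagre.exists_trace {A : Set (ℕ → Bool)} (hA : IsMeagre A) :
    ∃ R : ℕ → ℕ → Set (List Bool), (∀ k N, R k N ∈ nwd) ∧
      ∀ y ∈ A, ∀ᶠ k in atTop, ∀ N s, Passes y N s → s ∈ R k N := by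
  obtain ⟨F, hF, hFc, hAF⟩ := isMeagre_iff_countable_union_isNowhereDense.1 hA
  rcases F.eq_empty_or_nonempty with rfl | hne
  · exact ⟨fun _ _ => ∅, fun _ _ => nwd.bot_mem, fun y hy => by simpa using hAF hy⟩
  obtain ⟨C, rfl⟩ := hFc.exists_eq_range hne
  refine ⟨fun k N => ⋃ j ≤ k, {s | ∃ y ∈ C j, Passes y N s}, fun k N => biUnion_le_mem_nwd
    (fun j => setOf_exists_passes_mem_nwd (hF _ ⟨j, rfl⟩) N) k, fun y hy => ?_⟩
  obtain ⟨_, ⟨j, rfl⟩, hj⟩ := hAF hy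
  filter_upwards [eventually_ge_atTop j] with k hk N s hs
  simp only [Set.mem_iUnion]
  exact ⟨j, hk, y, hj, hs⟩

/-- The sequences that pass through only finitely many of the strings `s k` at `k`. -/
lemma isMeagre_setOf_eventually_not_passes (s : ℕ → List Bool) :
    IsMeagre {y | ∀ᶠ k in atTop, ¬ Passes y k (s k)} := by
  have : {y | ∀ᶠ k in atTop, ¬ Passes y k (s k)} = ⋃ K, {y | ∀ k ≥ K, ¬ Passes y k (s k)} := by
    ext y; simp [eventually_atTop]
  rw [this]
  refine isMeagre_iUnion fun K => IsNowhereDense.isMeagre ?_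
  refine isNowhereDense_iff_forall_exists_prefix.2 fun σ => ?_
  obtain ⟨k, hk⟩ : ∃ k, k = max K σ.length := ⟨_, rfl⟩
  refine ⟨σ ++ (List.replicate (k - σ.length) false ++ s k), List.prefix_append _ _,
    fun y hy hp => hy k (hk ▸ le_max_left _ _) ?_⟩
  have := (passes_append.1 (passes_append.1 hp).2).2
  rwa [List.length_replicate, zero_add, Nat.add_sub_cancel' (hk ▸ le_max_right _ _)] at this

/-- The sequences with infinitely many initial segments in a member of `nwd`. -/
lemma isMeagre_setOf_frequently_mem {B : Set (List Bool)} (hB : B ∈ nwd) :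
    IsMeagre {y : ℕ → Bool | ∃ᶠ m in atTop, (List.range m).map y ∈ B} := by
  refine IsNowhereDense.isMeagre (isNowhereDense_iff_forall_exists_prefix.2 fun σ => ?_)
  obtain ⟨τ, h1, h2⟩ := mem_nwd.1 hB σ
  refine ⟨τ, h1, fun y hy hp => ?_⟩
  obtain ⟨m, hm, hmB⟩ := frequently_atTop.1 hy τ.length
  refine h2 _ ?_ hmB
  rw [List.prefix_iff_getElem?]
  intro i hi
  have := hp i hi
  rw [List.getElem?_eq_getElem hi, zero_add] at this
  rw [List.getElem?_map, List.getElem?_range (hi.trans_le hm), this]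
  rfl

lemma passes_replicate_false {y : ℕ → Bool} {N n : ℕ} :
    Passes y N (List.replicate n false) ↔ ∀ i < n, y (N + i) = false := by
  unfold Passes
  rw [List.length_replicate]
  refine forall₂_congr fun i hi => ?_
  rw [List.getElem?_replicate, if_pos hi, Option.some_inj, eq_comm]

/-- If the sequences with blocks of zeros bounded by the `f a` form a meager set, then the monotone
functions `f a` have a common eventual bound. -/
lemma exists_bound_of_isMeagre {ι : Type*} {f : ι → ℕ → ℕ} (hf : ∀ a, Monotone (f a))
    (h : IsMeagre (⋃ a, {y : ℕ → Bool |
      ∀ᶠ n in atTop, ¬ Passes y n (List.replicate (f a n + 1) false)})) :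
    ∃ g : ℕ → ℕ, ∀ a, ∀ᶠ n in atTop, f a n ≤ g n := by
  obtain ⟨R, hR, hRA⟩ := IsMeagre.exists_trace h
  -- The final `true` will stop any run of zeros at the end of its block.
  have hex : ∀ k N, ∃ s, s ++ [true] ∉ R k N := fun k N => by
    obtain ⟨τ, -, hτ⟩ := mem_nwd.1 (hR k N) []
    exact ⟨τ, hτ _ (List.prefix_append _ _)⟩
  choose s hs using hex
  obtain ⟨i, hi⟩ : ∃ i : ℕ → ℕ, ∀ k, i (k + 1) = i k + (s k (i k)).length + 1 :=
    ⟨fun n => Nat.rec 0 (fun k N => N + (s k N).length + 1) n, fun _ => rfl⟩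
  have him : StrictMono i := strictMono_nat_of_lt_succ fun k => by rw [hi]; omega
  refine ⟨fun n => i (n + 1), fun a => ?_⟩
  by_contra hcon
  rw [not_eventually] at hcon
  -- Since `n ≤ i n` and `f a` is monotone, failure of the bound at `n` makes `f a` exceed the end
  -- of the `n`-th block already at its start.
  let bad : ℕ → Prop := fun n => i (n + 1) < f a (i n)
  have hbad : ∃ᶠ n in atTop, bad n := hcon.mono fun n hn =>
    (not_le.1 hn).trans_le (hf a him.le_apply)
  -- The zeros of a real `y` that copies the forbidden string on bad blocks and is `true` elsewhere.
  -- Its runs of zeros end within a bad block, hence are too short for `f a`, so `y` lies in the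
  -- meager union, yet it meets forbidden strings infinitely often.
  let Z : ℕ → Prop := fun j => ∃ n, bad n ∧ i n ≤ j ∧ j < i (n + 1) ∧
    (s n (i n) ++ [true])[j - i n]? = some false
  have hex : ∀ j, ∃ b : Bool, b = false ↔ Z j := fun j => by
    by_cases h : Z j
    exacts [⟨false, by simp [h]⟩, ⟨true, by simp [h]⟩]
  choose y hyZ using hex
  have huniq : ∀ n n' j, i n ≤ j → j < i (n + 1) → i n' ≤ j → j < i (n' + 1) → n' = n := by
    intro n n' j h1 h2 h3 h4
    have := him.lt_iff_lt.1 (h1.trans_lt h4)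
    have := him.lt_iff_lt.1 (h3.trans_lt h2)
    omega
  have hpass : ∀ n, bad n → Passes y (i n) (s n (i n) ++ [true]) := by
    intro n hn j hj
    have hj' : i n + j < i (n + 1) := by
      rw [hi]; rw [List.length_append, List.length_singleton] at hj; omega
    obtain ⟨b, hb⟩ : ∃ b, (s n (i n) ++ [true])[j]? = some b := ⟨_, List.getElem?_eq_getElem hj⟩
    rw [hb]
    congr 1
    cases b with
    | false =>
      exact ((hyZ _).2 ⟨n, hn, by omega, hj', by rwa [Nat.add_sub_cancel_left]⟩).symm
    | true =>
      refine (Bool.eq_true_of_not_eq_false fun h => ?_).symm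
      obtain ⟨n', -, h2, h3, h4⟩ := (hyZ _).1 h
      obtain rfl := huniq n n' (i n + j) (by omega) hj' h2 h3
      rw [Nat.add_sub_cancel_left, hb] at h4
      simp at h4
  have hyM : ∀ n, ¬ Passes y n (List.replicate (f a n + 1) false) := by
    intro n hp
    rw [passes_replicate_false] at hp
    obtain ⟨m, hm, h1, h2, -⟩ := (hyZ n).1 (hp 0 (by omega))
    have hlt : i (m + 1) < f a n := hm.trans_le (hf a h1)
    have hlast := (passes_append.1 (hpass m hm)).2 0 (by simp)
    have hfalse := hp (i m + (s m (i m)).length - n) (by rw [hi] at hlt; omega)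
    rw [Nat.add_sub_cancel' (by rw [hi] at h2; omega)] at hfalse
    simp [hfalse] at hlast
  obtain ⟨n, hn, hn'⟩ := (hbad.and_eventually
    (hRA y (Set.mem_iUnion.2 ⟨a, .of_forall hyM⟩))).exists
  exact hs _ _ (hn' _ _ (hpass n hn))

/-! ### The two inequalities -/

lemma preimage_mem_nwd {e : List Bool ≃ ℕ} {A : Set ℕ} : e ⁻¹' A ∈ nwd ↔ A ∈ nwdOn e := Iff.rfl

lemma singleton_mem_nwdOn (e : List Bool ≃ ℕ) (n : ℕ) : {n} ∈ nwdOn e := by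
  refine preimage_mem_nwd.1 (mem_nwd.2 fun σ => ⟨σ ++ List.replicate ((e.symm n).length + 1) false,
    List.prefix_append _ _, fun ρ hρ h => ?_⟩)
  obtain rfl : ρ = e.symm n := by
    rw [Equiv.eq_symm_apply]
    exact h
  have := hρ.length_le
  simp at this
  omega

lemma isMeagre_sUnion_of_hitSet_cover {e : List Bool ≃ ℕ} {F : Set (Set (ℕ → Bool))}
    {R : Set (ℕ → Bool) → ℕ → ℕ → Set (List Bool)}
    (hR : ∀ A ∈ F, ∀ y ∈ A, ∀ᶠ k in atTop, ∀ N s, Passes y N s → s ∈ R A k N)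
    {x : ℕ → ℕ} (hx : ∀ A ∈ F, x ∉ hitSet fun σ => e '' R A σ.length σ.length) :
    IsMeagre (⋃₀ F) := by
  refine (isMeagre_setOf_eventually_not_passes fun k => e.symm (x k)).mono ?_
  rintro y ⟨A, hA, hy⟩
  filter_upwards [hR A hA y hy, not_frequently.1 (hx A hA)] with k hk hxk hp
  refine hxk ⟨e.symm (x k), ?_, e.apply_symm_apply _⟩
  rw [initSeg_length]
  exact hk _ _ hp

theorem cov_le_add (e : List Bool ≃ ℕ) :
    cov (borelPart (laverTrees (nwdOn e))) ≤ add meager := by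
  refine le_csInf ⟨_, Set.range fun y : ℕ → Bool => {y}, ?_, ?_, rfl⟩ ?_
  · rintro _ ⟨y, rfl⟩
    refine IsNowhereDense.isMeagre (isNowhereDense_iff_forall_exists_prefix.2 fun σ =>
      ⟨σ ++ [!y σ.length], List.prefix_append _ _, ?_⟩)
    rintro _ rfl hp
    simpa using (passes_append.1 hp).2 0 (by simp)
  · intro h
    refine not_isMeagre_of_isOpen isOpen_univ Set.univ_nonempty (IsMeagre.mono ?_ h)
    exact fun y _ => ⟨{y}, ⟨y, rfl⟩, rfl⟩
  · rintro _ ⟨F, hF, hFU, rfl⟩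
    have hex : ∀ A, ∃ R : ℕ → ℕ → Set (List Bool), (∀ k N, R k N ∈ nwd) ∧ (A ∈ F →
        ∀ y ∈ A, ∀ᶠ k in atTop, ∀ N s, Passes y N s → s ∈ R k N) := fun A => by
      by_cases hA : A ∈ F
      · obtain ⟨R, h1, h2⟩ := IsMeagre.exists_trace (hF hA)
        exact ⟨R, h1, fun _ => h2⟩
      · exact ⟨fun _ _ => ∅, fun _ _ => nwd.bot_mem, fun h => absurd h hA⟩
    choose R hRn hR using hex
    refine le_trans (csInf_le' ?_) (mk_image_le (s := F)
      (f := fun A => hitSet fun σ => e '' R A σ.length σ.length))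
    refine ⟨_, ?_, ?_, rfl⟩
    · rintro _ ⟨A, -, rfl⟩
      refine hitSet_mem_borelPart (singleton_mem_nwdOn e) fun σ => preimage_mem_nwd.1 ?_
      rw [Set.preimage_image_eq _ e.injective]
      exact hRn _ _ _
    · refine Set.eq_univ_of_forall fun x => ?_
      by_contra hx
      refine hFU (isMeagre_sUnion_of_hitSet_cover (e := e) (x := x) hR fun A hA h => hx ?_)
      exact ⟨_, ⟨A, hA, rfl⟩, h⟩

lemma isMeagre_iUnion_of_lt_add {ι : Type} (hι : #ι < add meager) {M : ι → Set (ℕ → Bool)}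
    (hM : ∀ a, IsMeagre (M a)) : IsMeagre (⋃ a, M a) := by
  by_contra h
  refine (mk_range_le.trans_lt hι).not_ge (csInf_le' ⟨Set.range M, ?_, ?_, rfl⟩)
  · rintro _ ⟨a, rfl⟩
    exact hM a
  · rwa [Set.sUnion_range]

lemma exists_bound_of_lt_add {ι : Type} (hι : #ι < add meager) (f : ι → ℕ → ℕ) :
    ∃ g : ℕ → ℕ, ∀ a, ∀ᶠ n in atTop, f a n ≤ g n := by
  -- Partial suprema supply the monotonicity that the block argument needs.
  obtain ⟨g, hg⟩ := exists_bound_of_isMeagre (f := fun a => partialSups (f a))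
    (fun a => (partialSups (f a)).monotone)
    (isMeagre_iUnion_of_lt_add hι fun a => isMeagre_setOf_eventually_not_passes _)
  exact ⟨g, fun a => (hg a).mono fun n hn => (le_partialSups (f a) n).trans hn⟩

/-- Fewer than `add(M)` predictors are evaded by a single sequence. -/
lemma exists_forall_notMem_hitSet {e : List Bool ≃ ℕ} {ι : Type} (hι : #ι < add meager)
    {φ : ι → List ℕ → Set ℕ} (hφ : ∀ a σ, φ a σ ∈ nwdOn e) : ∃ x, ∀ a, x ∉ hitSet (φ a) := by
  have hc : ∀ σ, ∃ c : ℕ → Bool, ∀ a, ∃ m, ∀ k ≥ m, e ((List.range k).map c) ∉ φ a σ := by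
    intro σ
    have hM := isMeagre_iUnion_of_lt_add hι fun a =>
      isMeagre_setOf_frequently_mem (preimage_mem_nwd.2 (hφ a σ))
    obtain ⟨c, hc⟩ := (Set.ne_univ_iff_exists_notMem _).1 fun h =>
      not_isMeagre_of_isOpen isOpen_univ Set.univ_nonempty (hM.mono h.ge)
    refine ⟨c, fun a => ?_⟩
    have : ¬ ∃ᶠ m in atTop, (List.range m).map c ∈ e ⁻¹' φ a σ := fun h =>
      hc (Set.mem_iUnion.2 ⟨a, h⟩)
    exact eventually_atTop.1 (not_frequently.1 this)
  choose c m hm using hc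
  -- The thresholds are functions on finite sequences, coded by numbers to be dominated.
  obtain ⟨g, hg⟩ := exists_bound_of_lt_add hι fun a n => m (Denumerable.ofNat (List ℕ) n) a
  obtain ⟨x, hx⟩ := exists_forall_eq_initSeg
    fun σ => e ((List.range (g (Encodable.encode σ))).map (c σ))
  refine ⟨x, fun a => not_frequently.2 ?_⟩
  -- The initial segments of `x` have distinct codes, so domination at almost all codes holds at
  -- almost all of them.
  have ht : Tendsto (fun n => Encodable.encode (initSeg x n)) atTop atTop := by
    rw [← Nat.cofinite_eq_atTop]
    exact (Encodable.encode_injective.comp (initSeg_injective x)).tendsto_cofinite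
  filter_upwards [ht.eventually (hg a)] with n hn
  rw [Denumerable.ofNat_encode] at hn
  rw [hx n]
  exact hm _ a _ hn

theorem add_le_cov (e : List Bool ≃ ℕ) :
    add meager ≤ cov (borelPart (laverTrees (nwdOn e))) := by
  -- The infimum must range over a nonempty set: the whole ideal covers, since each `x` is caught by
  -- the predictor with values `{x n}`.
  refine le_csInf ⟨_, borelPart (laverTrees (nwdOn e)), subset_rfl, ?_, rfl⟩ ?_
  · refine Set.eq_univ_of_forall fun x => ⟨_, hitSet_mem_borelPart (singleton_mem_nwdOn e)
      fun σ => singleton_mem_nwdOn e (x σ.length), ?_⟩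
    exact Frequently.of_forall fun n => by simp [initSeg_length]
  · rintro _ ⟨F, hF, hFU, rfl⟩
    by_contra! hlt
    choose φ hφ hsub using fun A : F =>
      exists_subset_hitSet_of_mem_borelPart (singleton_mem_nwdOn e) (hF A.2)
    obtain ⟨x, hx⟩ := exists_forall_notMem_hitSet hlt hφ
    obtain ⟨A, hA, hxA⟩ : x ∈ ⋃₀ F := hFU ▸ Set.mem_univ x
    exact hx ⟨A, hA⟩ (hsub ⟨A, hA⟩ hxA)

end TreeIdeal

theorem mainTheorem11 (e : List Bool ≃ ℕ) :
    TreeIdeal.cov (TreeIdeal.borelPart (TreeIdeal.laverTrees (TreeIdeal.nwdOn e))) =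
      TreeIdeal.add TreeIdeal.meager :=
  (TreeIdeal.cov_le_add e).antisymm (TreeIdeal.add_le_cov e)
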